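/- Let $A, Z \in \mathbb{R}^{m\times n}$, let $\operatorname{rank}(A) = r$, and put $B = A + Z$. For $X\in\mathbb{R}^{m\times n}$ let $\sigma_1(X)\ge\sigma_2(X)\ge\dots\ge\sigma_{m\wedge n}(X)\ge 0$ be its singular values, and for $q\in[1,\infty]$ let $\|X\|_q=\big(\sum_{i=1}^{m\wedge n}\sigma_i(X)^q\big)^{1/q}$ be its Schatten-$q$ norm (for $q=\infty$, the largest singular value). Let $$B = [\widehat U\ \widehat U_\perp]\,\widehat\Sigma\,[\widehat V\ \widehat V_\perp]^\top$$ be any singular value decomposition of $B$, where $[\widehat U\ \widehat U_\perp]\in\mathbb{R}^{m\times m}$ and $[\widehat V\ \widehat V_\perp]\in\mathbb{R}^{n\times n}$ are orthogonal, $\widehat\Sigma \in\mathbb{R}^{m\times n}$ is pseudo-diagonal with the singular values of $B$ in decreasing order, and $\widehat U$, $\widehat V$ consist of the first $r$ columns. Write $P_{\widehat U_\perp}=\widehat U_\perp\widehat U_\perp^\top$ and $P_{\widehat V_\perp}=\widehat V_\perp\widehat V_\perp^\top$. For any singular value decomposition $Z=\sum_{i=1}^{m\wedge n}\sigma_i(Z)u_iv_i^\top$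 let $Z_{\max(r)}=\sum_{i=1}^{r}\sigma_i(Z)u_iv_i^\top$. Then for every $q\in[1,\infty]$, $$\max\big\{\|P_{\widehat U_\perp}A\|_q,\ \|A P_{\widehat V_\perp}\|_q\big\}\le 2\,\|Z_{\max(r)}\|_q .$$ -/

import Mathlib

open scoped ENNReal

/-- `singVal A i` is the `(i+1)`-st largest singular value of the real matrix `A`
(counting from `i = 0`, with multiplicity; it is `0` for `i ≥ min m n`). -/
noncomputable def singVal {m n : ℕ} (A : Matrix (Fin m) (Fin n) ℝ) (i : ℕ) : ℝ :=
  (Matrix.toEuclideanLin A).singularValues i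

/-- The Schatten-`q` norm, for `q ∈ [1, ∞]`: the `ℓ^q` norm of the `min m n` singular values,
which for `q = ∞` is their maximum. -/
noncomputable def schattenNorm {m n : ℕ} (q : ℝ≥0∞) (A : Matrix (Fin m) (Fin n) ℝ) : ℝ :=
  if q = ∞ then ⨆ i : Fin (min m n), singVal A i
  else (∑ i : Fin (min m n), singVal A i ^ q.toReal) ^ (1 / q.toReal)

/-- The `m × n` pseudo-diagonal matrix with diagonal entries `s 0, s 1, …`. -/
def rectDiag (m n : ℕ) (s : ℕ → ℝ) : Matrix (Fin m) (Fin n) ℝ :=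
  Matrix.of fun i j => if i.val = j.val then s i.val else 0

/-- `B = U Σ Vᵀ` is a (full) singular value decomposition of `B`: `U` and `V` are orthogonal and
`Σ` is pseudo-diagonal and carries the singular values of `B` in decreasing order. -/
def IsSVD {m n : ℕ} (B : Matrix (Fin m) (Fin n) ℝ)
    (U : Matrix (Fin m) (Fin m) ℝ) (V : Matrix (Fin n) (Fin n) ℝ) : Prop :=
  U ∈ Matrix.orthogonalGroup (Fin m) ℝ ∧ V ∈ Matrix.orthogonalGroup (Fin n) ℝ ∧
    B = U * rectDiag m n (singVal B) * V.transpose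

/-- The truncation `Z_{max(r)} = ∑_{i < r} σ_i(Z) u_i v_iᵀ` (with `i` counted from `0`) of `Z` to
its `r` leading singular values, where `u_i` and `v_i` are the columns of `U` and `V`. -/
noncomputable def truncSVD {m n : ℕ} (Z : Matrix (Fin m) (Fin n) ℝ)
    (U : Matrix (Fin m) (Fin m) ℝ) (V : Matrix (Fin n) (Fin n) ℝ) (r : ℕ) :
    Matrix (Fin m) (Fin n) ℝ :=
  U * rectDiag m n (fun i => if i < r then singVal Z i else 0) * V.transpose

/-- The block `U_⊥` in `U = [U₁ U_⊥]`, where `U₁` consists of the first `r` columns of `U`. -/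
def trailingCols {p : ℕ} (U : Matrix (Fin p) (Fin p) ℝ) (r : ℕ) :
    Matrix (Fin p) {j : Fin p // r ≤ j.val} ℝ :=
  U.submatrix id Subtype.val

/-- `P_W = W Wᵀ`, which for `W` with orthonormal columns is the orthogonal projection onto the
column span of `W`. -/
def colProj {p : ℕ} {ι : Type*} [Fintype ι] (W : Matrix (Fin p) ι ℝ) :
    Matrix (Fin p) (Fin p) ℝ :=
  W * W.transpose

/-- Every real matrix has a singular value decomposition. -/
theorem exists_isSVD {m n : ℕ} (B : Matrix (Fin m) (Fin n) ℝ) : ∃ U V, IsSVD B U V := by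
  set T := Matrix.toEuclideanLin B with hT
  have hn : Module.finrank ℝ (EuclideanSpace ℝ (Fin n)) = n := by simp
  let v := T.isSymmetric_adjoint_comp_self.eigenvectorBasis hn
  have hin : ∀ i j : Fin n, inner ℝ (T (v i)) (T (v j)) =
      if i = j then (T.singularValues j) ^ 2 else 0 := by
    intro i j
    rw [← LinearMap.adjoint_inner_right, ← LinearMap.comp_apply,
      LinearMap.IsSymmetric.apply_eigenvectorBasis, inner_smul_right,
      orthonormal_iff_ite.mp v.orthonormal, T.sq_singularValues_fin hn]
    simp
  let w : Fin m → EuclideanSpace ℝ (Fin m) := fun i =>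
    if h : i.val < n then (T.singularValues i)⁻¹ • T (v ⟨i, h⟩) else 0
  let s : Set (Fin m) := {i | T.singularValues i ≠ 0}
  have hlt : ∀ k, T.singularValues k ≠ 0 → k < n := by
    intro k hk
    by_contra h
    exact hk (T.singularValues_of_finrank_le (by rw [hn]; omega))
  have hw : Orthonormal ℝ (s.domRestrict w) := by
    rw [orthonormal_iff_ite]
    rintro ⟨i, hi⟩ ⟨j, hj⟩
    have hi' := hlt _ hi
    have hj' := hlt _ hj
    simp only [s, Set.mem_ofPred_eq] at hi hj
    change inner ℝ (w i) (w j) = _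
    simp only [w, hi', hj', dif_pos, inner_smul_left, inner_smul_right, hin]
    by_cases h : i = j
    · subst h; simp; field_simp
    · have : i.val ≠ j.val := fun h' => h (Fin.ext h')
      simp [h, this]
  obtain ⟨u, hu⟩ := hw.exists_orthonormalBasis_extension_of_card_eq (by simp)
  have hTv : ∀ j : Fin n, ∀ k : Fin m, T (v j) k =
      if h : j.val < m then T.singularValues j * u ⟨j, h⟩ k else 0 := by
    intro j k
    by_cases h0 : T.singularValues j = 0
    · have : T (v j) = 0 := by
        rw [← inner_self_eq_zero (𝕜 := ℝ), hin]; simp [h0]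
      simp [this, h0]
    · have hjm : j.val < m := by
        have := (T.singularValues_pos_iff_ne_zero j).2 h0
        rw [T.singularValues_pos_iff_lt_finrank_range] at this
        refine this.trans_le ((Submodule.finrank_le _).trans (by simp))
      rw [dif_pos hjm, hu ⟨j, hjm⟩ h0]
      simp [w]
      field_simp
  let U : Matrix (Fin m) (Fin m) ℝ := Matrix.of fun i j => u j i
  let V : Matrix (Fin n) (Fin n) ℝ := Matrix.of fun i j => v j i
  have hO : ∀ (p : ℕ) (b : OrthonormalBasis (Fin p) ℝ (EuclideanSpace ℝ (Fin p))),
      (Matrix.of fun i j => b j i) ∈ Matrix.orthogonalGroup (Fin p) ℝ := by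
    intro p b
    rw [Matrix.mem_orthogonalGroup_iff']
    ext i j
    have := orthonormal_iff_ite.mp b.orthonormal i j
    simp only [PiLp.inner_apply] at this
    simpa [Matrix.mul_apply, Matrix.one_apply, Matrix.star_eq_conjTranspose, mul_comm] using this
  refine ⟨U, V, hO m u, hO n v, ?_⟩
  have hV := hO n v
  have key : B * V = U * rectDiag m n (singVal B) := by
    ext k j
    have := hTv j k
    have e : T (v j) k = (B * V) k j := by
      simp [hT, Matrix.mul_apply, V, Matrix.toEuclideanLin, Matrix.toLpLin_apply, Matrix.mulVec, dotProduct]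
    rw [← e, this]
    simp only [Matrix.mul_apply, rectDiag, U, Matrix.of_apply, singVal, ← hT]
    by_cases h : j.val < m
    · rw [dif_pos h, Finset.sum_eq_single ⟨j, h⟩]
      · simp [mul_comm]
      · intro b _ hb
        have : b.val ≠ j.val := fun h' => hb (Fin.ext h')
        simp [this]
      · simp
    · rw [dif_neg h, Finset.sum_eq_zero]
      intro b _
      have : b.val ≠ j.val := by omega
      simp [this]
  rw [← key, Matrix.mul_assoc]
  have : V * V.transpose = 1 := by
    have := (Matrix.mem_orthogonalGroup_iff (Fin n) ℝ).1 hV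
    simpa [Matrix.star_eq_conjTranspose] using this
  rw [this, Matrix.mul_one]

/-! Write `P A = P B - P Z` with `P` the projection onto the trailing left singular vectors of `B`.
In `P B` only the singular values of `B` from index `r` on survive, and since `A` has rank `r`,
Weyl's inequality (`singVal_add_rank_le`) bounds them termwise by those of `Z`. Also `P A` has rank
at most `r`, so only its first `r` singular values count. In singular bases of `P A` these are
differences of diagonal entries of two products `G Σ H` with contractions `G`, `H`. Each such
diagonal is a doubly substochastic average of singular values. Jensen and rearrangement therefore
bound its `ℓ^p` norm on `r` positions by that of the `r` leading singular values of `Z`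
(`rectDiagOf_bounds`). Minkowski adds the two bounds, whence the factor 2. The argument for `A P` is
the same, with the projection acting on the right. -/

/-! ### Rearrangement, Jensen and substochastic averages. -/

/-- Rearrangement: weights in `[0, 1]` of total mass at most `r`, attached to distinct terms of an
antitone sequence, give at most the sum of its first `r` terms. -/
theorem Antitone.sum_mul_le_sum_range {κ : Type*} {τ : ℕ → ℝ} (hτ : Antitone τ)
    (hτ0 : ∀ j, 0 ≤ τ j) (S : Finset κ) (e : κ → ℕ) (he : Set.InjOn e S) (c : κ → ℝ)
    (hc0 : ∀ k ∈ S, 0 ≤ c k) (hc1 : ∀ k ∈ S, c k ≤ 1) (r : ℕ) (hr : ∑ k ∈ S, c k ≤ r) :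
    ∑ k ∈ S, c k * τ (e k) ≤ ∑ j ∈ Finset.range r, τ j := by
  -- The value `τ r` serves as a threshold: the excess above it is counted with full weight 1, and
  -- only indices below `r` have any.
  have h1 : ∀ k ∈ S, c k * τ (e k) ≤ c k * τ r + if e k < r then τ (e k) - τ r else 0 := by
    intro k hk
    split_ifs with h
    · nlinarith [hτ h.le, hc0 k hk, hc1 k hk]
    · nlinarith [hτ (not_lt.1 h), hc0 k hk]
  have h2 : ∑ k ∈ S, (if e k < r then τ (e k) - τ r else 0)
      ≤ ∑ j ∈ Finset.range r, (τ j - τ r) := by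
    rw [← Finset.sum_filter, ← Finset.sum_image (f := fun j => τ j - τ r)
      (he.mono (by intro x hx; exact (Finset.mem_filter.1 hx).1))]
    refine Finset.sum_le_sum_of_subset_of_nonneg ?_ ?_
    · intro j hj
      simp only [Finset.mem_image, Finset.mem_filter] at hj
      obtain ⟨k, ⟨_, hk⟩, rfl⟩ := hj
      exact Finset.mem_range.2 hk
    · intro j hj _
      exact sub_nonneg.2 (hτ (Finset.mem_range.1 hj).le)
  calc ∑ k ∈ S, c k * τ (e k)
      ≤ ∑ k ∈ S, (c k * τ r + if e k < r then τ (e k) - τ r else 0) := Finset.sum_le_sum h1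
    _ ≤ r * τ r + ∑ j ∈ Finset.range r, (τ j - τ r) := by
        rw [Finset.sum_add_distrib, ← Finset.sum_mul]
        exact add_le_add (mul_le_mul_of_nonneg_right hr (hτ0 r)) h2
    _ = _ := by simp [Finset.sum_sub_distrib]

/-- Jensen's inequality for powers, for weights of total mass at most one. -/
theorem Real.rpow_sum_mul_le_sum_mul_rpow {κ : Type*} (S : Finset κ) (w z : κ → ℝ)
    (hw : ∀ k ∈ S, 0 ≤ w k) (hw1 : ∑ k ∈ S, w k ≤ 1) (hz : ∀ k ∈ S, 0 ≤ z k) {p : ℝ}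
    (hp : 1 ≤ p) : (∑ k ∈ S, w k * z k) ^ p ≤ ∑ k ∈ S, w k * z k ^ p := by
  -- The extra point `none` takes the missing mass at value 0, which contributes nothing since `p ≠
  -- 0`.
  have := Real.rpow_arith_mean_le_arith_mean_rpow S.insertNone
    (fun o => o.elim (1 - ∑ k ∈ S, w k) w) (fun o => o.elim 0 z) (by
      rintro (_ | k) hk
      · simpa using hw1
      · exact hw k (by simpa using hk)) (by simp) (by
      rintro (_ | k) hk
      · simp
      · exact hz k (by simpa using hk)) hp
  simpa [Real.zero_rpow (by linarith : p ≠ 0)] using this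

section Substochastic

variable {ι κ : Type*} {w : ι → κ → ℝ} {S : Finset κ} {e : κ → ℕ} {τ : ℕ → ℝ}
  {b : ι → ℝ}

theorem abs_le_of_substochastic (hw0 : ∀ i k, 0 ≤ w i k) (hrow : ∀ i, ∑ k ∈ S, w i k ≤ 1)
    (hτ : Antitone τ) (hτ0 : ∀ j, 0 ≤ τ j) (hb : ∀ i, |b i| ≤ ∑ k ∈ S, w i k * τ (e k)) (i : ι) :
    |b i| ≤ τ 0 :=
  calc |b i| ≤ ∑ k ∈ S, w i k * τ 0 := (hb i).trans
        (Finset.sum_le_sum fun k _ => mul_le_mul_of_nonneg_left (hτ (Nat.zero_le _)) (hw0 i k))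
    _ ≤ τ 0 := by rw [← Finset.sum_mul]; exact mul_le_of_le_one_left (hτ0 0) (hrow i)

/-- Row sums allow Jensen in each row. After the sums are exchanged, column sums keep each weight at
most 1 and row sums keep the total mass at most `I.card`, so rearrangement applies to `τ ^ p`. -/
theorem sum_rpow_le_of_substochastic [Fintype ι] (hw0 : ∀ i k, 0 ≤ w i k) (hrow : ∀ i, ∑ k ∈ S, w i k ≤ 1)
    (hcol : ∀ k, ∑ i, w i k ≤ 1) (he : Set.InjOn e S) (hτ : Antitone τ) (hτ0 : ∀ j, 0 ≤ τ j)
    (hb : ∀ i, |b i| ≤ ∑ k ∈ S, w i k * τ (e k)) {p : ℝ} (hp : 1 ≤ p) (I : Finset ι) {r : ℕ}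
    (hI : I.card ≤ r) :
    ∑ i ∈ I, |b i| ^ p ≤ ∑ j ∈ Finset.range r, τ j ^ p := by
  have hp0 : 0 ≤ p := by linarith
  calc ∑ i ∈ I, |b i| ^ p ≤ ∑ i ∈ I, ∑ k ∈ S, w i k * τ (e k) ^ p := by
        refine Finset.sum_le_sum fun i _ => ?_
        exact (Real.rpow_le_rpow (abs_nonneg _) (hb i) hp0).trans
          (Real.rpow_sum_mul_le_sum_mul_rpow S _ _ (fun k _ => hw0 i k) (hrow i)
            (fun k _ => hτ0 _) hp)
    _ = ∑ k ∈ S, (∑ i ∈ I, w i k) * τ (e k) ^ p := by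
        rw [Finset.sum_comm]
        simp_rw [Finset.sum_mul]
    _ ≤ _ := by
        refine Antitone.sum_mul_le_sum_range (τ := fun j => τ j ^ p)
          (fun i j hij => Real.rpow_le_rpow (hτ0 j) (hτ hij) hp0)
          (fun j => Real.rpow_nonneg (hτ0 j) p) S e he _
          (fun k _ => Finset.sum_nonneg fun i _ => hw0 i k)
          (fun k _ => (Finset.sum_le_univ_sum_of_nonneg fun i => hw0 i k).trans (hcol k)) r ?_
        rw [Finset.sum_comm]
        calc ∑ i ∈ I, ∑ k ∈ S, w i k ≤ ∑ i ∈ I, (1 : ℝ) := Finset.sum_le_sum fun i _ => hrow i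
          _ ≤ r := by simpa using hI

end Substochastic

/-! ### Contractions and diagonals of products `G Σ H`. -/

section SingVal

variable {m n : ℕ}

theorem singVal_nonneg (A : Matrix (Fin m) (Fin n) ℝ) (i : ℕ) : 0 ≤ singVal A i :=
  LinearMap.singularValues_nonneg _ i

theorem singVal_antitone (A : Matrix (Fin m) (Fin n) ℝ) : Antitone (singVal A) :=
  LinearMap.singularValues_antitone _

theorem singVal_eq_zero_of_rank_le {A : Matrix (Fin m) (Fin n) ℝ} {i : ℕ} (h : A.rank ≤ i) :
    singVal A i = 0 := by
  rw [singVal, LinearMap.singularValues_eq_zero_iff_le_finrank_range]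
  rwa [Matrix.rank_eq_finrank_range_toLin A (EuclideanSpace.basisFun _ ℝ).toBasis
    (EuclideanSpace.basisFun _ ℝ).toBasis, ← Matrix.toEuclideanLin_eq_toLin_orthonormal] at h

theorem singVal_eq_zero_of_min_le (A : Matrix (Fin m) (Fin n) ℝ) {i : ℕ} (h : min m n ≤ i) :
    singVal A i = 0 :=
  singVal_eq_zero_of_rank_le <| (le_min (by simpa using A.rank_le_card_height)
    (by simpa using A.rank_le_card_width)).trans h

/-- `W` is a contraction: `W Wᵀ ≤ 1` and `Wᵀ W ≤ 1`. -/
def IsContr {p : ℕ} (W : Matrix (Fin p) (Fin p) ℝ) : Prop :=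
  (1 - W * W.transpose).PosSemidef ∧ (1 - W.transpose * W).PosSemidef

section orthogonal

variable {p : ℕ} {U W : Matrix (Fin p) (Fin p) ℝ}

theorem mul_transpose_of_orthogonal (hU : U ∈ Matrix.orthogonalGroup (Fin p) ℝ) :
    U * U.transpose = 1 := by
  simpa [Matrix.star_eq_conjTranspose] using (Matrix.mem_orthogonalGroup_iff (Fin p) ℝ).1 hU

theorem transpose_mul_of_orthogonal (hU : U ∈ Matrix.orthogonalGroup (Fin p) ℝ) :
    U.transpose * U = 1 := by
  simpa [Matrix.star_eq_conjTranspose] using (Matrix.mem_orthogonalGroup_iff' (Fin p) ℝ).1 hU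

theorem IsContr.of_orthogonal (hU : U ∈ Matrix.orthogonalGroup (Fin p) ℝ) : IsContr U := by
  simp [IsContr, mul_transpose_of_orthogonal hU, transpose_mul_of_orthogonal hU,
    Matrix.PosSemidef.zero]

theorem IsContr.transpose (hW : IsContr W) : IsContr W.transpose := by
  simpa [IsContr] using hW.symm

/-- `1 - UW(UW)ᵀ = U(1 - WWᵀ)Uᵀ + (1 - UUᵀ)`, and symmetrically. This lets a projection be absorbed
into an orthogonal factor. -/
theorem IsContr.mul (hW : IsContr W) (hU : IsContr U) : IsContr (U * W) := by
  constructor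
  · have := (hW.1.mul_mul_conjTranspose_same U).add hU.1
    convert this using 1
    simp [Matrix.conjTranspose_eq_transpose_of_trivial, Matrix.mul_sub, Matrix.sub_mul,
      Matrix.mul_assoc]
  · have := (hU.2.conjTranspose_mul_mul_same W).add hW.2
    convert this using 1
    simp [Matrix.conjTranspose_eq_transpose_of_trivial, Matrix.mul_sub, Matrix.sub_mul,
      Matrix.mul_assoc]

theorem IsContr.sum_row_sq_le (hW : IsContr W) (i : Fin p) : ∑ k, W i k ^ 2 ≤ 1 := by
  simpa [Matrix.mul_apply, sq] using hW.1.diag_nonneg (i := i)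

theorem IsContr.sum_col_sq_le (hW : IsContr W) (k : Fin p) : ∑ i, W i k ^ 2 ≤ 1 := by
  simpa using hW.transpose.sum_row_sq_le k

end orthogonal

theorem mul_rectDiag_mul_apply (G : Matrix (Fin m) (Fin m) ℝ) (H : Matrix (Fin n) (Fin n) ℝ)
    (s : ℕ → ℝ) (a : Fin m) (b : Fin n) :
    (G * rectDiag m n s * H) a b = ∑ k : Fin (min m n),
      G a (k.castLE (min_le_left m n)) * s k * H (k.castLE (min_le_right m n)) b := by
  rw [Matrix.mul_apply]
  symm
  refine Fintype.sum_of_injective (Fin.castLE (min_le_right m n)) (Fin.castLE_injective _) _ _ ?_ ?_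
  · intro j hj
    have hj' : m ≤ j.val := by
      by_contra h
      exact hj ⟨⟨j, lt_min (not_le.1 h) j.2⟩, rfl⟩
    rw [Matrix.mul_apply, Finset.sum_eq_zero, zero_mul]
    intro i _
    have : i.val ≠ j.val := by omega
    simp [rectDiag, this]
  · intro k
    congr 1
    rw [Matrix.mul_apply, Finset.sum_eq_single (k.castLE (min_le_left m n))]
    · simp [rectDiag]
    · intro i _ hi
      have : i.val ≠ k.val := fun h => hi (Fin.ext h)
      simp [rectDiag, this]
    · simp

theorem sum_castLE_le {d p : ℕ} (h : d ≤ p) (f : Fin p → ℝ) (hf : ∀ i, 0 ≤ f i) :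
    ∑ k : Fin d, f (k.castLE h) ≤ ∑ i, f i := by
  rw [← Finset.sum_image (s := Finset.univ) (g := Fin.castLE h) (f := f)
    (Fin.castLE_injective h).injOn]
  exact Finset.sum_le_univ_sum_of_nonneg hf

/-- The absolute values of the products that enter the diagonal of `G Σ H`. -/
def diagWeight (G : Matrix (Fin m) (Fin m) ℝ) (H : Matrix (Fin n) (Fin n) ℝ)
    (i k : Fin (min m n)) : ℝ :=
  |G (i.castLE (min_le_left m n)) (k.castLE (min_le_left m n)) *
    H (k.castLE (min_le_right m n)) (i.castLE (min_le_right m n))|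

theorem diagWeight_le (G : Matrix (Fin m) (Fin m) ℝ) (H : Matrix (Fin n) (Fin n) ℝ)
    (i k : Fin (min m n)) :
    diagWeight G H i k ≤ (G (i.castLE (min_le_left m n)) (k.castLE (min_le_left m n)) ^ 2 +
      H (k.castLE (min_le_right m n)) (i.castLE (min_le_right m n)) ^ 2) / 2 := by
  rw [diagWeight, abs_mul, ← sq_abs (G _ _), ← sq_abs (H _ _)]
  linarith [two_mul_le_add_sq |G (i.castLE (min_le_left m n)) (k.castLE (min_le_left m n))|
    |H (k.castLE (min_le_right m n)) (i.castLE (min_le_right m n))|]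

variable {G : Matrix (Fin m) (Fin m) ℝ} {H : Matrix (Fin n) (Fin n) ℝ}

/-- By AM-GM the sum is at most the mean of the squared norms of a row of `G` and a column of `H`.
-/
theorem sum_diagWeight_row_le (hG : IsContr G) (hH : IsContr H) (i : Fin (min m n)) :
    ∑ k, diagWeight G H i k ≤ 1 := by
  refine (Finset.sum_le_sum fun k _ => diagWeight_le G H i k).trans ?_
  rw [← Finset.sum_div, Finset.sum_add_distrib]
  have h1 := (sum_castLE_le (min_le_left m n) (fun k => G (i.castLE (min_le_left m n)) k ^ 2)
    fun _ => sq_nonneg _).trans (hG.sum_row_sq_le _)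
  have h2 := (sum_castLE_le (min_le_right m n) (fun k => H k (i.castLE (min_le_right m n)) ^ 2)
    fun _ => sq_nonneg _).trans (hH.sum_col_sq_le _)
  linarith

theorem sum_diagWeight_col_le (hG : IsContr G) (hH : IsContr H) (k : Fin (min m n)) :
    ∑ i, diagWeight G H i k ≤ 1 := by
  refine (Finset.sum_le_sum fun i _ => diagWeight_le G H i k).trans ?_
  rw [← Finset.sum_div, Finset.sum_add_distrib]
  have h1 := (sum_castLE_le (min_le_left m n) (fun i => G i (k.castLE (min_le_left m n)) ^ 2)
    fun _ => sq_nonneg _).trans (hG.sum_col_sq_le _)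
  have h2 := (sum_castLE_le (min_le_right m n) (fun i => H (k.castLE (min_le_right m n)) i ^ 2)
    fun _ => sq_nonneg _).trans (hH.sum_row_sq_le _)
  linarith

/-- The diagonal of a rectangular matrix. -/
def rectDiagOf (X : Matrix (Fin m) (Fin n) ℝ) (i : Fin (min m n)) : ℝ :=
  X (i.castLE (min_le_left m n)) (i.castLE (min_le_right m n))

/-- If `s` is dominated by an antitone sequence `τ` shifted by `r`, then the diagonal of `G Σ H` is
dominated in `ℓ^p`, on any `r'` positions, by the first `r'` terms of `τ`, and in `ℓ^∞` by the
first one. -/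
theorem rectDiagOf_bounds (hG : IsContr G) (hH : IsContr H) {s τ : ℕ → ℝ} {r : ℕ}
    (hτ : Antitone τ) (hτ0 : ∀ j, 0 ≤ τ j) (hs0 : ∀ k < r, s k = 0)
    (hs : ∀ k, |s (r + k)| ≤ τ k) :
    (∀ i, |rectDiagOf (G * rectDiag m n s * H) i| ≤ τ 0) ∧
    ∀ (p : ℝ), 1 ≤ p → ∀ (I : Finset (Fin (min m n))) (r' : ℕ), I.card ≤ r' →
      ∑ i ∈ I, |rectDiagOf (G * rectDiag m n s * H) i| ^ p ≤ ∑ j ∈ Finset.range r', τ j ^ p := by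
  set S : Finset (Fin (min m n)) := Finset.univ.filter fun k => r ≤ k.val with hS
  have hw0 : ∀ i k, 0 ≤ diagWeight G H i k := fun i k => abs_nonneg _
  have hrow : ∀ i, ∑ k ∈ S, diagWeight G H i k ≤ 1 := fun i =>
    (Finset.sum_le_univ_sum_of_nonneg (hw0 i)).trans (sum_diagWeight_row_le hG hH i)
  have hb : ∀ i, |rectDiagOf (G * rectDiag m n s * H) i| ≤
      ∑ k ∈ S, diagWeight G H i k * τ (k.val - r) := by
    intro i
    rw [rectDiagOf, mul_rectDiag_mul_apply]
    refine (Finset.abs_sum_le_sum_abs _ _).trans ?_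
    rw [hS, Finset.sum_filter]
    refine Finset.sum_le_sum fun k _ => ?_
    split_ifs with h
    · rw [mul_right_comm, abs_mul]
      refine mul_le_mul_of_nonneg_left ?_ (hw0 i k)
      simpa [Nat.add_sub_cancel' h] using hs (k.val - r)
    · simp [hs0 k (not_le.1 h)]
  have he : Set.InjOn (fun k : Fin (min m n) => k.val - r) S := by
    intro a ha b hb hab
    simp only [hS, Finset.coe_filter, Finset.mem_univ, true_and, Set.mem_ofPred_eq] at ha hb
    simp only at hab
    exact Fin.ext (by omega)
  exact ⟨abs_le_of_substochastic hw0 hrow hτ hτ0 hb, fun p hp I r' hI =>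
    sum_rpow_le_of_substochastic hw0 hrow (sum_diagWeight_col_le hG hH) he hτ hτ0 hb hp I hI⟩

end SingVal

/-! ### Truncations, Weyl's inequality and trailing projections. -/

section SVD

variable {m n : ℕ}

theorem rectDiagOf_transpose_mul_mul {U : Matrix (Fin m) (Fin m) ℝ} {V : Matrix (Fin n) (Fin n) ℝ}
    (hU : U ∈ Matrix.orthogonalGroup (Fin m) ℝ) (hV : V ∈ Matrix.orthogonalGroup (Fin n) ℝ)
    (s : ℕ → ℝ) (i : Fin (min m n)) :
    rectDiagOf (U.transpose * (U * rectDiag m n s * V.transpose) * V) i = s i := by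
  have : U.transpose * (U * rectDiag m n s * V.transpose) * V = rectDiag m n s := by
    rw [Matrix.mul_assoc, Matrix.mul_assoc _ V.transpose, transpose_mul_of_orthogonal hV,
      Matrix.mul_one, ← Matrix.mul_assoc, transpose_mul_of_orthogonal hU, Matrix.one_mul]
  rw [rectDiagOf, this]
  simp [rectDiag]

theorem sum_range_singVal_rpow_eq (A : Matrix (Fin m) (Fin n) ℝ) {p : ℝ} (hp : 1 ≤ p) (r : ℕ) :
    ∑ j ∈ Finset.range r, singVal A j ^ p =
      ∑ i : Fin (min m n), (if i.val < r then singVal A i else 0) ^ p := by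
  have hp0 : p ≠ 0 := by linarith
  rw [Fin.sum_univ_eq_sum_range (fun j => (if j < r then singVal A j else 0) ^ p)]
  have h : ∀ j, (if j < r then singVal A j else 0) ^ p = if j < r then singVal A j ^ p else 0 := by
    intro j; split_ifs <;> simp [Real.zero_rpow hp0]
  simp_rw [h]
  rw [← Finset.sum_filter]
  symm
  refine Finset.sum_subset ?_ ?_
  · intro j hj
    simpa using (Finset.mem_filter.1 hj).2
  · intro j hj hj'
    have : min m n ≤ j := by
      by_contra hlt
      exact hj' (Finset.mem_filter.2 ⟨Finset.mem_range.2 (not_le.1 hlt), Finset.mem_range.1 hj⟩)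
    rw [singVal_eq_zero_of_min_le A this, Real.zero_rpow hp0]

/-- The leading singular values of `Z` are the diagonal of `Uᵀ T V` for the truncation `T`.
Expanding `T` in an SVD of its own puts this diagonal under `rectDiagOf_bounds`, so the singular
values of `T` need not be identified. -/
theorem truncSVD_bounds {Z : Matrix (Fin m) (Fin n) ℝ} {U : Matrix (Fin m) (Fin m) ℝ}
    {V : Matrix (Fin n) (Fin n) ℝ} (hZ : IsSVD Z U V) (r : ℕ) :
    (0 < r → singVal Z 0 ≤ singVal (truncSVD Z U V r) 0) ∧
    ∀ p : ℝ, 1 ≤ p → ∑ j ∈ Finset.range r, singVal Z j ^ p ≤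
      ∑ i : Fin (min m n), singVal (truncSVD Z U V r) i ^ p := by
  obtain ⟨hU, hV, -⟩ := hZ
  obtain ⟨U', V', hU', hV', hT⟩ := exists_isSVD (truncSVD Z U V r)
  set T := truncSVD Z U V r with hTdef
  have key := rectDiagOf_bounds (G := U.transpose * U') (H := V'.transpose * V)
    (s := singVal T) (τ := singVal T) (r := 0)
    ((IsContr.of_orthogonal hU').mul (IsContr.of_orthogonal hU).transpose)
    ((IsContr.of_orthogonal hV).mul (IsContr.of_orthogonal hV').transpose)
    (singVal_antitone T) (singVal_nonneg T) (by simp)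
    (by intro k; simp [abs_of_nonneg (singVal_nonneg T k)])
  have e : U.transpose * U' * rectDiag m n (singVal T) * (V'.transpose * V) =
      U.transpose * (U * rectDiag m n (fun i => if i < r then singVal Z i else 0) *
        V.transpose) * V := by
    rw [← truncSVD, ← hTdef]
    conv_rhs => rw [hT]
    simp only [Matrix.mul_assoc]
  simp_rw [e, rectDiagOf_transpose_mul_mul hU hV] at key
  have habs : ∀ i : ℕ, |if i < r then singVal Z i else 0| = if i < r then singVal Z i else 0 := by
    intro i; split_ifs <;> simp [abs_of_nonneg (singVal_nonneg Z _)]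
  simp_rw [habs] at key
  constructor
  · intro hr
    rcases Nat.eq_zero_or_pos (min m n) with h0 | h0
    · rw [singVal_eq_zero_of_min_le Z (by omega)]
      exact singVal_nonneg _ _
    · simpa [hr] using key.1 ⟨0, h0⟩
  · intro p hp
    rw [sum_range_singVal_rpow_eq Z hp, Fin.sum_univ_eq_sum_range (fun j => singVal T j ^ p)]
    exact key.2 p hp Finset.univ _ (by simp)

theorem transpose_rectDiag_mul_rectDiag (s : ℕ → ℝ) :
    (rectDiag m n s).transpose * rectDiag m n s =
      Matrix.diagonal fun j : Fin n => if j.val < m then s j ^ 2 else 0 := by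
  ext i j
  rw [Matrix.mul_apply, Matrix.diagonal_apply]
  by_cases hi : i.val < m
  · rw [Finset.sum_eq_single ⟨i, hi⟩]
    · by_cases h : i = j
      · subst h; simp [rectDiag, hi, sq]
      · have : i.val ≠ j.val := fun h' => h (Fin.ext h')
        simp [rectDiag, h, this]
    · intro k _ hk
      have : k.val ≠ i.val := fun h => hk (Fin.ext h)
      simp [rectDiag, this]
    · simp
  · rw [Finset.sum_eq_zero]
    · simp [hi]
    · intro k _
      have : k.val ≠ i.val := by omega
      simp [rectDiag, this]

theorem IsSVD.dotProduct_mulVec_self {B : Matrix (Fin m) (Fin n) ℝ}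
    {U : Matrix (Fin m) (Fin m) ℝ} {V : Matrix (Fin n) (Fin n) ℝ} (h : IsSVD B U V)
    (x : Fin n → ℝ) :
    B.mulVec x ⬝ᵥ B.mulVec x = ∑ j : Fin n, singVal B j ^ 2 * (V.transpose.mulVec x) j ^ 2 := by
  have hBB : B.transpose * B = V * Matrix.diagonal (fun j : Fin n => singVal B j ^ 2) *
      V.transpose := by
    -- The cutoff at `m` is harmless because singular values vanish from index `min m n` on.
    have h0 : (fun j : Fin n => if j.val < m then singVal B j ^ 2 else 0) =
        fun j : Fin n => singVal B j ^ 2 := by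
      ext j
      split_ifs with hj
      · rfl
      · rw [singVal_eq_zero_of_min_le B (by omega)]; simp
    rw [← h0, ← transpose_rectDiag_mul_rectDiag]
    conv_lhs => rw [h.2.2]
    simp only [Matrix.transpose_mul, Matrix.transpose_transpose, Matrix.mul_assoc]
    rw [← Matrix.mul_assoc U.transpose U, transpose_mul_of_orthogonal h.1, Matrix.one_mul]
  have h1 : B.mulVec x ⬝ᵥ B.mulVec x = x ⬝ᵥ (B.transpose * B).mulVec x := by
    rw [← Matrix.mulVec_mulVec, Matrix.dotProduct_mulVec x, Matrix.vecMul_transpose]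
  rw [h1, hBB, ← Matrix.mulVec_mulVec, ← Matrix.mulVec_mulVec, Matrix.dotProduct_mulVec,
    ← Matrix.mulVec_transpose, dotProduct]
  refine Finset.sum_congr rfl fun j _ => ?_
  rw [Matrix.mulVec_diagonal]
  ring

theorem sum_transpose_mulVec_sq {V : Matrix (Fin n) (Fin n) ℝ}
    (hV : V ∈ Matrix.orthogonalGroup (Fin n) ℝ) (x : Fin n → ℝ) :
    ∑ j, (V.transpose.mulVec x) j ^ 2 = x ⬝ᵥ x := by
  have : ∑ j, (V.transpose.mulVec x) j ^ 2 = V.transpose.mulVec x ⬝ᵥ V.transpose.mulVec x := by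
    simp [dotProduct, sq]
  rw [this, Matrix.dotProduct_mulVec, Matrix.vecMul_transpose, Matrix.mulVec_mulVec,
    mul_transpose_of_orthogonal hV, Matrix.one_mulVec]

/-- Weyl's inequality for a perturbation of a matrix of rank `r`. -/
theorem singVal_add_rank_le (A Z : Matrix (Fin m) (Fin n) ℝ) (k : ℕ) :
    singVal (A + Z) (A.rank + k) ≤ singVal Z k := by
  set r := A.rank with hr
  set B := A + Z with hB
  by_cases hk : n ≤ r + k
  · rw [singVal_eq_zero_of_min_le B (by omega)]
    exact singVal_nonneg _ _
  push Not at hk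
  obtain ⟨U, V, hUV⟩ := exists_isSVD B
  obtain ⟨UZ, VZ, hZ⟩ := exists_isSVD Z
  -- `N` parametrises the span of the first `r + k + 1` right singular vectors of `B`. The map `L`
  -- records `A x` and the first `k` coordinates of `x` in the right singular basis of `Z`; its
  -- target has dimension only `r + k`, so some nonzero `x` is killed by all these conditions.
  let ι : (Fin (r + k + 1) → ℝ) →ₗ[ℝ] (Fin n → ℝ) :=
    Function.ExtendByZero.linearMap ℝ (Fin.castLE hk)
  let N : (Fin (r + k + 1) → ℝ) →ₗ[ℝ] (Fin n → ℝ) := V.mulVecLin ∘ₗ ι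
  let L : (Fin (r + k + 1) → ℝ) →ₗ[ℝ] LinearMap.range A.mulVecLin × (Fin k → ℝ) :=
    (A.mulVecLin.rangeRestrict ∘ₗ N).prod
      (LinearMap.funLeft ℝ ℝ (Fin.castLE (by omega : k ≤ n)) ∘ₗ VZ.transpose.mulVecLin ∘ₗ N)
  have hker : LinearMap.ker L ≠ ⊥ := by
    refine LinearMap.ker_ne_bot_of_finrank_lt ?_
    rw [Module.finrank_prod, Module.finrank_fin_fun, Module.finrank_fin_fun]
    change A.rank + k < _
    omega
  obtain ⟨y, hy, hy0⟩ := (Submodule.ne_bot_iff _).1 hker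
  set x := N y with hx
  have hLy : L y = 0 := hy
  have hAx : A.mulVec x = 0 := congrArg (fun z => (z.1 : Fin m → ℝ)) hLy
  have hZx : ∀ j : Fin n, j.val < k → (VZ.transpose.mulVec x) j = 0 := fun j hj =>
    congrFun (congrArg Prod.snd hLy) ⟨j, hj⟩
  have hVx : V.transpose.mulVec x = ι y := by
    change V.transpose.mulVec (V.mulVec (ι y)) = ι y
    rw [Matrix.mulVec_mulVec, transpose_mul_of_orthogonal hUV.2.1, Matrix.one_mulVec]
  have hιy : ∀ j : Fin n, r + k < j.val → ι y j = 0 := by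
    intro j hj
    refine Function.extend_apply' _ _ _ ?_
    rintro ⟨a, rfl⟩
    have := a.2
    simp only [Fin.val_castLE] at hj
    omega
  have hx0 : 0 < x ⬝ᵥ x := by
    rw [← sum_transpose_mulVec_sq hUV.2.1, hVx]
    obtain ⟨a, ha⟩ := Function.ne_iff.1 hy0
    have : ι y (Fin.castLE hk a) = y a := (Fin.castLE_injective hk).extend_apply _ _ _
    refine lt_of_lt_of_le ?_ (Finset.single_le_sum (fun j _ => sq_nonneg (ι y j))
      (Finset.mem_univ (Fin.castLE hk a)))
    rw [this]
    exact sq_pos_of_ne_zero ha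
  have hlow : singVal B (r + k) ^ 2 * (x ⬝ᵥ x) ≤ B.mulVec x ⬝ᵥ B.mulVec x := by
    rw [hUV.dotProduct_mulVec_self, ← sum_transpose_mulVec_sq hUV.2.1, Finset.mul_sum]
    refine Finset.sum_le_sum fun j _ => ?_
    by_cases hj : j.val ≤ r + k
    · exact mul_le_mul_of_nonneg_right
        (pow_le_pow_left₀ (singVal_nonneg _ _) (singVal_antitone B hj) 2) (sq_nonneg _)
    · rw [hVx, hιy j (not_le.1 hj)]; simp
  have hup : Z.mulVec x ⬝ᵥ Z.mulVec x ≤ singVal Z k ^ 2 * (x ⬝ᵥ x) := by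
    rw [hZ.dotProduct_mulVec_self, ← sum_transpose_mulVec_sq hZ.2.1, Finset.mul_sum]
    refine Finset.sum_le_sum fun j _ => ?_
    by_cases hj : k ≤ j.val
    · exact mul_le_mul_of_nonneg_right
        (pow_le_pow_left₀ (singVal_nonneg _ _) (singVal_antitone Z hj) 2) (sq_nonneg _)
    · rw [hZx j (not_le.1 hj)]; simp
  -- On this `x` the two quadratic forms agree, so `hlow` and `hup` can be chained.
  have hBZ : B.mulVec x = Z.mulVec x := by rw [hB, Matrix.add_mulVec, hAx, zero_add]
  rw [hBZ] at hlow
  exact le_of_sq_le_sq (le_of_mul_le_mul_right (hlow.trans hup) hx0) (singVal_nonneg _ _)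

theorem colProj_trailingCols {p : ℕ} (U : Matrix (Fin p) (Fin p) ℝ) (r : ℕ) :
    colProj (trailingCols U r) =
      U * Matrix.diagonal (fun k : Fin p => if r ≤ k.val then (1 : ℝ) else 0) * U.transpose := by
  ext i j
  rw [colProj, Matrix.mul_apply, Matrix.mul_apply]
  simp only [trailingCols, Matrix.transpose_apply, Matrix.submatrix_apply, id, Matrix.mul_diagonal]
  rw [← Finset.sum_subtype (Finset.univ.filter fun k : Fin p => r ≤ k.val) (by simp)
    (fun k => U i k * U j k), Finset.sum_filter]
  refine Finset.sum_congr rfl fun k _ => ?_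
  split_ifs <;> simp

theorem transpose_colProj {p : ℕ} {ι : Type*} [Fintype ι] (W : Matrix (Fin p) ι ℝ) :
    (colProj W).transpose = colProj W := by
  simp [colProj]

theorem isContr_colProj_trailingCols {p : ℕ} {U : Matrix (Fin p) (Fin p) ℝ}
    (hU : U ∈ Matrix.orthogonalGroup (Fin p) ℝ) (r : ℕ) :
    IsContr (colProj (trailingCols U r)) := by
  rw [colProj_trailingCols]
  refine (IsContr.of_orthogonal hU).transpose.mul (IsContr.mul ?_ (IsContr.of_orthogonal hU))
  have h : (1 - Matrix.diagonal (fun k : Fin p => if r ≤ k.val then (1 : ℝ) else 0) *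
      Matrix.diagonal (fun k : Fin p => if r ≤ k.val then (1 : ℝ) else 0)).PosSemidef := by
    rw [Matrix.diagonal_mul_diagonal, ← Matrix.diagonal_one, Matrix.diagonal_sub]
    refine Matrix.PosSemidef.diagonal fun k => ?_
    by_cases hk : r ≤ k.val <;> simp [hk]
  simpa [IsContr] using h

theorem diagonal_mul_rectDiag (r : ℕ) (s : ℕ → ℝ) :
    Matrix.diagonal (fun k : Fin m => if r ≤ k.val then (1 : ℝ) else 0) * rectDiag m n s =
      rectDiag m n fun k => if r ≤ k then s k else 0 := by
  ext i j
  rw [Matrix.diagonal_mul]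
  simp only [rectDiag, Matrix.of_apply]
  split_ifs <;> simp

theorem rectDiag_mul_diagonal (r : ℕ) (s : ℕ → ℝ) :
    rectDiag m n s * Matrix.diagonal (fun k : Fin n => if r ≤ k.val then (1 : ℝ) else 0) =
      rectDiag m n fun k => if r ≤ k then s k else 0 := by
  ext i j
  rw [Matrix.mul_diagonal]
  simp only [rectDiag, Matrix.of_apply]
  split_ifs with h1 h2 h3 <;> first | omega | simp

/-- Common form of the two halves: for both `P A` and `A P`, `M` splits into a tail part `s`
dominated by the singular values of `Z` and a compression of `Z`. -/
theorem schattenNorm_le_two_mul {M Z : Matrix (Fin m) (Fin n) ℝ} {r : ℕ} (hM : M.rank ≤ r)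
    {U₁ U₂ UZ : Matrix (Fin m) (Fin m) ℝ} {V₁ V₂ VZ : Matrix (Fin n) (Fin n) ℝ}
    (hU₁ : IsContr U₁) (hU₂ : IsContr U₂) (hV₁ : IsContr V₁) (hV₂ : IsContr V₂)
    {s : ℕ → ℝ} (hs0 : ∀ k < r, s k = 0) (hs : ∀ k, |s (r + k)| ≤ singVal Z k)
    (hMe : M = U₁ * rectDiag m n s * V₁.transpose -
      U₂ * rectDiag m n (singVal Z) * V₂.transpose)
    (hZ : IsSVD Z UZ VZ) {q : ℝ≥0∞} (hq : 1 ≤ q) :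
    schattenNorm q M ≤ 2 * schattenNorm q (truncSVD Z UZ VZ r) := by
  obtain ⟨hT0, hT⟩ := truncSVD_bounds hZ r
  set T := truncSVD Z UZ VZ r
  obtain ⟨U, V, hU, hV, hMs⟩ := exists_isSVD M
  have hUc := (IsContr.of_orthogonal hU).transpose
  have hVc := IsContr.of_orthogonal hV
  obtain ⟨hb0, hb⟩ := rectDiagOf_bounds (hU₁.mul hUc) (hVc.mul hV₁.transpose)
    (singVal_antitone Z) (singVal_nonneg Z) hs0 hs
  obtain ⟨hz0, hz⟩ := rectDiagOf_bounds (hU₂.mul hUc) (hVc.mul hV₂.transpose)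
    (singVal_antitone Z) (singVal_nonneg Z) (s := singVal Z) (r := 0) (by simp)
    (by intro k; simp [abs_of_nonneg (singVal_nonneg Z k)])
  set b := rectDiagOf (U.transpose * U₁ * rectDiag m n s * (V₁.transpose * V))
  set z := rectDiagOf (U.transpose * U₂ * rectDiag m n (singVal Z) * (V₂.transpose * V))
  have hle : ∀ i : Fin (min m n), singVal M i ≤ |b i| + |z i| := by
    intro i
    have h1 : singVal M i = b i - z i := by
      rw [← rectDiagOf_transpose_mul_mul hU hV (singVal M) i, ← hMs, hMe]
      simp only [b, z, rectDiagOf, Matrix.mul_sub, Matrix.sub_mul, Matrix.mul_assoc,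
        Matrix.sub_apply]
    rw [h1]
    exact (le_abs_self _).trans (abs_sub _ _)
  have hzero : ∀ i, r ≤ i → singVal M i = 0 := fun i hi =>
    singVal_eq_zero_of_rank_le (hM.trans hi)
  unfold schattenNorm
  split_ifs with hqt
  · have hT' : ∀ i : Fin (min m n), singVal T i ≤ ⨆ i : Fin (min m n), singVal T i := fun i =>
      le_ciSup (f := fun i : Fin (min m n) => singVal T i) (Set.finite_range _).bddAbove i
    have hTn : 0 ≤ ⨆ i : Fin (min m n), singVal T i := Real.iSup_nonneg fun i => singVal_nonneg T i
    -- Nonnegativity of the bound covers `min m n = 0`, where the real supremum is 0 by convention.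
    refine Real.iSup_le (fun i => ?_) (by positivity)
    by_cases hi : r ≤ i.val
    · rw [hzero i hi]; positivity
    · have h1 := hT0 (by omega)
      have h2 := hT' ⟨0, by have := i.2; omega⟩
      have h3 := hle i
      have h4 := hb0 i
      have h5 := hz0 i
      simp only at h2
      linarith
  · have hp : 1 ≤ q.toReal := by
      simpa using ENNReal.toReal_mono hqt hq
    set p := q.toReal
    have hp0 : p ≠ 0 := by linarith
    set I : Finset (Fin (min m n)) := Finset.univ.filter fun i => i.val < r with hI
    have hIc : I.card ≤ r := by
      rw [← Finset.card_image_of_injective I Fin.val_injective]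
      refine (Finset.card_le_card (t := Finset.range r) ?_).trans (by simp)
      intro j hj
      simp only [hI, Finset.mem_image, Finset.mem_filter, Finset.mem_univ, true_and] at hj
      obtain ⟨i, hi, rfl⟩ := hj
      exact Finset.mem_range.2 hi
    have hsum : ∑ i : Fin (min m n), singVal M i ^ p = ∑ i ∈ I, singVal M i ^ p := by
      symm
      refine Finset.sum_subset (Finset.subset_univ _) fun i _ hi => ?_
      rw [hzero i (by simpa [hI] using hi), Real.zero_rpow hp0]
    have hbound : ∀ f : Fin (min m n) → ℝ,
        ∑ i ∈ I, |f i| ^ p ≤ ∑ j ∈ Finset.range r, singVal Z j ^ p →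
        (∑ i ∈ I, |f i| ^ p) ^ (1 / p) ≤ (∑ i : Fin (min m n), singVal T i ^ p) ^ (1 / p) :=
      fun f hf => Real.rpow_le_rpow
        (Finset.sum_nonneg fun i _ => Real.rpow_nonneg (abs_nonneg _) _)
        (hf.trans (hT p hp)) (by positivity)
    rw [hsum, two_mul]
    calc (∑ i ∈ I, singVal M i ^ p) ^ (1 / p)
        ≤ (∑ i ∈ I, (|b i| + |z i|) ^ p) ^ (1 / p) := by
          refine Real.rpow_le_rpow
            (Finset.sum_nonneg fun i _ => Real.rpow_nonneg (singVal_nonneg _ _) _) ?_ (by positivity)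
          exact Finset.sum_le_sum fun i _ =>
            Real.rpow_le_rpow (singVal_nonneg _ _) (hle i) (by linarith)
      _ ≤ (∑ i ∈ I, |b i| ^ p) ^ (1 / p) + (∑ i ∈ I, |z i| ^ p) ^ (1 / p) :=
          Real.Lp_add_le_of_nonneg I hp (fun i _ => abs_nonneg _) fun i _ => abs_nonneg _
      _ ≤ _ := add_le_add (hbound b (hb p hp I r hIc)) (hbound z (hz p hp I r hIc))

end SVD

/-! ### The two-sided projection bound. -/

theorem theorem2 (m n r : ℕ) (A Z B : Matrix (Fin m) (Fin n) ℝ)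
    (hB : B = A + Z) (hA : A.rank = r)
    (U : Matrix (Fin m) (Fin m) ℝ) (V : Matrix (Fin n) (Fin n) ℝ) (hUV : IsSVD B U V)
    (UZ : Matrix (Fin m) (Fin m) ℝ) (VZ : Matrix (Fin n) (Fin n) ℝ) (hZ : IsSVD Z UZ VZ)
    (q : ℝ≥0∞) (hq : 1 ≤ q) :
    max (schattenNorm q (colProj (trailingCols U r) * A))
        (schattenNorm q (A * colProj (trailingCols V r)))
      ≤ 2 * schattenNorm q (truncSVD Z UZ VZ r) := by
  have hs0 : ∀ k < r, (fun k => if r ≤ k then singVal B k else 0) k = 0 := fun k hk => by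
    simp [not_le.2 hk]
  have hs : ∀ k, |(fun k => if r ≤ k then singVal B k else 0) (r + k)| ≤ singVal Z k := fun k => by
    simpa [abs_of_nonneg (singVal_nonneg _ _), ← hA, hB] using singVal_add_rank_le A Z k
  have hAe : A = B - Z := by rw [hB, add_sub_cancel_right]
  have hUc := IsContr.of_orthogonal hUV.1
  have hVc := IsContr.of_orthogonal hUV.2.1
  have hUZ := IsContr.of_orthogonal hZ.1
  have hVZ := IsContr.of_orthogonal hZ.2.1
  refine max_le ?_ ?_
  -- The projection truncates `Σ` in the `B` term, where it is diagonal in the basis `U`; in the `Z`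
  -- term it is absorbed into `UZ` as a contraction.
  · refine schattenNorm_le_two_mul ((Matrix.rank_mul_le_right _ _).trans hA.le) hUc
      (hUZ.mul (isContr_colProj_trailingCols hUV.1 r)) hVc hVZ hs0 hs ?_ hZ hq
    rw [Matrix.mul_assoc _ UZ, Matrix.mul_assoc _ (UZ * _), ← hZ.2.2, hAe, Matrix.mul_sub]
    congr 1
    conv_lhs => rw [hUV.2.2, colProj_trailingCols]
    simp only [Matrix.mul_assoc]
    rw [← Matrix.mul_assoc U.transpose U, transpose_mul_of_orthogonal hUV.1, Matrix.one_mul,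
      ← Matrix.mul_assoc (Matrix.diagonal _), diagonal_mul_rectDiag]
  · refine schattenNorm_le_two_mul ((Matrix.rank_mul_le_left _ _).trans hA.le) hUc hUZ hVc
      (hVZ.mul (isContr_colProj_trailingCols hUV.2.1 r)) hs0 hs ?_ hZ hq
    rw [Matrix.transpose_mul, transpose_colProj, ← Matrix.mul_assoc _ VZ.transpose, ← hZ.2.2, hAe,
      Matrix.sub_mul]
    congr 1
    conv_lhs => rw [hUV.2.2, colProj_trailingCols]
    simp only [Matrix.mul_assoc]
    rw [← Matrix.mul_assoc V.transpose V, transpose_mul_of_orthogonal hUV.2.1, Matrix.one_mul,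
      ← Matrix.mul_assoc (rectDiag _ _ _), rectDiag_mul_diagonal]
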